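/- For a set $A \subseteq \{0,1,2,\ldots\}$ let $\partial A = \{z \in A : \{z-1,z+1\} \not\subseteq A\}$ be its boundary, and put $\mathrm{vol}(A) = \sum_{z \in A} z$ and $\mathrm{per}(A) = \sum_{z \in \partial A} z$ (so both are $0$ for $A=\emptyset$). Write $A^c = \{0,1,2,\ldots\}\setminus A$, and for every integer $n \ge 0$ define \[ P(n) = \min\{\mathrm{per}(A) : A \subseteq \{0,1,2,\ldots\},\ \mathrm{vol}(A) = n\}, \qquad Q(n) = \min\{\mathrm{per}(A^c) : A \subseteq \{0,1,2,\ldots\},\ \mathrm{vol}(A) = n\}, \] \[ f(n) = \left\lfloor \sqrt{2n} + \tfrac12 \right\rfloor, \qquad g(n) = \frac{f(n)\,(f(n)+1)}{2} - n . \] Let $E$ be the following set of $177$ integers: $\{0, 2, 4, 7, 8, 11, 16, 17, 29, 92, 125, 154, 155, 174, 361, 390, 441, 473, 529, 564, 601, 637, 704, 742, 743, 783, 837, 1003, 1147, 1184, 1340, 1341, 1380, 1394, 1548, 1549, 1606, 1665, 1771, 1772, 1833, 1896, 2173, 2241, 2279, 2508, 2581, 2867, 2945, 3250, 3333, 3336,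 3503, 3588, 3657, 3745, 3748, 3925, 4015, 4016, 4107, 4466, 4467, 4563, 4564, 4661, 5186, 5289, 5806, 5915, 6026, 6461, 6576, 6693, 6811, 7151, 7272, 7395, 7396, 7436, 7519, 8003, 8132, 8133, 8262, 8305, 9222, 9454, 10086, 10187, 10478, 11200, 11245, 11505, 12261, 12467, 12580, 12583, 12904, 13066, 13370, 13703, 13752, 14041, 14210, 14381, 15052, 15227, 15402, 15403, 15580, 15759, 16511, 17254, 17441, 17985, 18955, 19152, 19522, 20532, 20533, 20737, 21122, 21961, 22172, 22173, 22385, 22654, 22814, 23656, 23875, 23876, 24096, 24541, 24598, 26855, 28726, 28783, 28968, 30910, 31161, 33174, 33434, 35518, 35787, 36391, 37147, 39125, 39625, 39626, 39909, 41958, 44890, 47921, 50126, 51051, 53326, 53327, 53655, 56625, 56626, 56964, 61851, 65764, 66129, 69797, 70173, 73950, 74337, 78223, 78621, 108375, 114014, 129359, 136036, 142881, 149894\}$. Let $n \ge 0$ be an integer with $g(n) < f(n) - 1$, $n \notin E$ and $n - f(n) \notin E$ (here $0 \le f(n) \le n$ always holds). Then \[ P(n) = 1 + P(n - f(n)) \qquad\text{and}\qquad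 Q(n) = 1 + Q(n - f(n)). \] -/

import Mathlib

open scoped ENNReal

noncomputable section

namespace VolPer

/-- The boundary of `A ⊆ {0, 1, …}`: the elements of `A` whose predecessor or successor is not
in `A`. The predecessor of `0` is `-1`, which never lies in `A`. -/
def boundary (A : Set ℕ) : Set ℕ :=
  {z | z ∈ A ∧ ¬ ((∃ y ∈ A, y + 1 = z) ∧ z + 1 ∈ A)}

/-- The volume of `A`: the sum of its elements (infinite if the sum diverges). -/
def vol (A : Set ℕ) : ℝ≥0∞ := ∑' z : A, ((z : ℕ) : ℝ≥0∞)

/-- The perimeter of `A`: the sum of the elements of its boundary. -/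
def per (A : Set ℕ) : ℝ≥0∞ := ∑' z : boundary A, ((z : ℕ) : ℝ≥0∞)

/-- `P n` is the minimum of `per A` over all `A ⊆ {0, 1, …}` of volume `n`;
see `isLeast_P` for attainment. -/
def P (n : ℕ) : ℕ := sInf {m : ℕ | ∃ A : Set ℕ, vol A = n ∧ per A = m}

/-- `Q n` is the minimum of `per Aᶜ` over all `A ⊆ {0, 1, …}` of volume `n`;
see `isLeast_Q` for attainment. -/
def Q (n : ℕ) : ℕ := sInf {m : ℕ | ∃ A : Set ℕ, vol A = n ∧ per Aᶜ = m}

/-- `f n = ⌊√(2n) + 1/2⌋`, the integer nearest to `√(2n)`. -/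
def f (n : ℕ) : ℕ := ⌊Real.sqrt (2 * (n : ℝ)) + 1 / 2⌋₊

/-- `g n = f n (f n + 1) / 2 - n`, an exact division, with integer subtraction. -/
def g (n : ℕ) : ℤ := (f n : ℤ) * ((f n : ℤ) + 1) / 2 - (n : ℤ)

/-- The 177 tabulated exceptional values of `n`. -/
def exceptions : List ℕ :=
  [0, 2, 4, 7, 8, 11, 16, 17, 29, 92, 125, 154, 155, 174, 361, 390, 441, 473, 529, 564,
   601, 637, 704, 742, 743, 783, 837, 1003, 1147, 1184, 1340, 1341, 1380, 1394, 1548,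
   1549, 1606, 1665, 1771, 1772, 1833, 1896, 2173, 2241, 2279, 2508, 2581, 2867, 2945,
   3250, 3333, 3336, 3503, 3588, 3657, 3745, 3748, 3925, 4015, 4016, 4107, 4466, 4467,
   4563, 4564, 4661, 5186, 5289, 5806, 5915, 6026, 6461, 6576, 6693, 6811, 7151, 7272,
   7395, 7396, 7436, 7519, 8003, 8132, 8133, 8262, 8305, 9222, 9454, 10086, 10187,
   10478, 11200, 11245, 11505, 12261, 12467, 12580, 12583, 12904, 13066, 13370, 13703,
   13752, 14041, 14210, 14381, 15052, 15227, 15402, 15403, 15580, 15759, 16511, 17254,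
   17441, 17985, 18955, 19152, 19522, 20532, 20533, 20737, 21122, 21961, 22172, 22173,
   22385, 22654, 22814, 23656, 23875, 23876, 24096, 24541, 24598, 26855, 28726, 28783,
   28968, 30910, 31161, 33174, 33434, 35518, 35787, 36391, 37147, 39125, 39625, 39626,
   39909, 41958, 44890, 47921, 50126, 51051, 53326, 53327, 53655, 56625, 56626, 56964,
   61851, 65764, 66129, 69797, 70173, 73950, 74337, 78223, 78621, 108375, 114014,
   129359, 136036, 142881, 149894]

set_option maxRecDepth 10000 in
theorem length_exceptions : exceptions.length = 177 := rfl

theorem exists_nat_of_finite {S : Set ℕ} (hS : S.Finite) :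
    ∃ m : ℕ, ∑' z : S, ((z : ℕ) : ℝ≥0∞) = m := by
  have := hS.fintype
  refine ⟨∑ z : S, (z : ℕ), ?_⟩
  rw [tsum_fintype]
  push_cast
  rfl

theorem vol_singleton (n : ℕ) : vol {n} = n := by
  unfold vol
  simp

/-- The minimum defining `P n` is attained. -/
theorem isLeast_P (n : ℕ) : IsLeast {m : ℕ | ∃ A : Set ℕ, vol A = n ∧ per A = m} (P n) := by
  refine ⟨Nat.sInf_mem ?_, fun m hm => Nat.sInf_le hm⟩
  obtain ⟨m, hm⟩ := exists_nat_of_finite (S := boundary {n})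
    ((Set.finite_singleton n).subset fun z hz => hz.1)
  exact ⟨m, {n}, vol_singleton n, hm⟩

/-- The minimum defining `Q n` is attained. -/
theorem isLeast_Q (n : ℕ) : IsLeast {m : ℕ | ∃ A : Set ℕ, vol A = n ∧ per Aᶜ = m} (Q n) := by
  refine ⟨Nat.sInf_mem ?_, fun m hm => Nat.sInf_le hm⟩
  obtain ⟨m, hm⟩ := exists_nat_of_finite (S := boundary {n}ᶜ) (by
    refine (Set.finite_Iic (n + 1)).subset fun z hz => ?_
    by_contra h
    simp only [Set.mem_Iic, not_le] at h
    refine hz.2 ⟨⟨z - 1, ?_, by omega⟩, ?_⟩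
    · simp only [Set.mem_compl_iff, Set.mem_singleton_iff]
      omega
    · simp only [Set.mem_compl_iff, Set.mem_singleton_iff]
      omega)
  exact ⟨m, {n}, vol_singleton n, hm⟩

/-- The natural-number difference `n - f n` is never truncated. -/
theorem f_le (n : ℕ) : f n ≤ n := by
  rcases Nat.eq_zero_or_pos n with rfl | hn
  · have h : f 0 = 0 := by
      unfold f
      rw [Nat.floor_eq_zero]
      norm_num
    exact h.le
  · have h : f n < n + 1 := by
      unfold f
      rw [Nat.floor_lt (by positivity)]
      have h1 : (1 : ℝ) ≤ n := by exact_mod_cast hn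
      have h2 : Real.sqrt (2 * (n : ℝ)) < (n : ℝ) + 1 / 2 := by
        rw [Real.sqrt_lt' (by positivity)]
        nlinarith
      push_cast
      linarith
    omega

end VolPer

end

/-! Let `m` be the largest element of `A` and `B = {0, …, m} \ A`, so that `vol B = tri m - n`. Then
`per Aᶜ = m + 1 + per B`, and `per A = m + per Bᶜ` unless `m` is isolated in `A`. Hence `P` and `Q`
obey a mutual recursion over `m ≥ f n`, because `f n` is the least `m` with `n ≤ tri m`
(`exists_le_P`, `exists_le_Q`, with `P_le_add_Q` and `Q_le_add_P` as partial converses).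

Outside the exceptions `m = f n` is optimal: `P n = f n + Q (gap n)` and `Q n = f n + 1 + P (gap n)`
(`P_eq`, `Q_eq`). If `gap n < f n - 1`, then `n - f n` has the same gap and its `f` is smaller by
one, so comparing the formulas at `n` and at `n - f n` gives the theorem.

For optimality write `F = f n` and `G = gap n < F`. Taking `m = F + 1` replaces the argument `G` by
`G + F + 1 ≥ 2 * G + 2` and costs one more. Both functions are at least `f`, of order `√(2n)`, and a
linear upper bound passed once through the recursion bounds them by about `6/5 * f`. As `√2 > 6/5`,
the change cannot pay for `G ≥ 947`; smaller `G` are checked by computation, with the listed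
exceptions excused (`P_Q_gap_le`). An isolated maximum is excluded by `Q_gap_le_f_sub`. -/

namespace VolPer

/-! ### Triangular numbers and volumes -/

/-- The `m`-th triangular number. -/
def tri (m : ℕ) : ℕ := m * (m + 1) / 2

theorem two_mul_tri (m : ℕ) : 2 * tri m = m * (m + 1) :=
  Nat.mul_div_cancel' (Nat.even_mul_succ_self m).two_dvd

theorem tri_succ (m : ℕ) : tri (m + 1) = tri m + (m + 1) := by
  have h := two_mul_tri m
  have h' := two_mul_tri (m + 1)
  nlinarith

theorem tri_strictMono : StrictMono tri :=
  strictMono_nat_of_lt_succ fun m => by rw [tri_succ]; omega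

theorem vol_union {A B : Set ℕ} (h : Disjoint A B) : vol (A ∪ B) = vol A + vol B :=
  Summable.tsum_union_disjoint h ENNReal.summable ENNReal.summable

theorem vol_mono {A B : Set ℕ} (h : A ⊆ B) : vol A ≤ vol B :=
  ENNReal.tsum_mono_subtype _ h

theorem vol_union_le (A B : Set ℕ) : vol (A ∪ B) ≤ vol A + vol B := by
  rw [← Set.union_sdiff_self, vol_union Set.disjoint_sdiff_right]
  gcongr
  exact vol_mono Set.sdiff_subset

theorem le_and_eq_sub_of_add_eq {a c : ℕ} {x : ℝ≥0∞} (h : a + x = c) :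
    a ≤ c ∧ x = (c - a : ℕ) := by
  have hle : a ≤ c := by
    have : (a : ℝ≥0∞) ≤ c := h ▸ le_self_add
    exact_mod_cast this
  refine ⟨hle, ?_⟩
  obtain ⟨d, rfl⟩ := Nat.exists_eq_add_of_le hle
  rw [Nat.add_sub_cancel_left]
  push_cast at h
  exact (ENNReal.add_right_inj (ENNReal.natCast_ne_top a)).1 h

theorem vol_Iic (m : ℕ) : vol (Set.Iic m) = tri m := by
  induction m with
  | zero =>
    have : Set.Iic 0 = ({0} : Set ℕ) := by ext; simp
    rw [this, vol_singleton]
    rfl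
  | succ m ih =>
    have : Set.Iic (m + 1) = Set.Iic m ∪ {m + 1} := by
      ext z
      simp only [Set.mem_Iic, Set.mem_union, Set.mem_singleton_iff]
      omega
    rw [this, vol_union (by simp), ih, vol_singleton, tri_succ]
    push_cast
    rfl

theorem le_vol {A : Set ℕ} {z : ℕ} (hz : z ∈ A) : (z : ℝ≥0∞) ≤ vol A := by
  rw [← vol_singleton z]
  exact vol_mono (by simpa using hz)

theorem le_of_mem_of_vol_eq {A : Set ℕ} {n z : ℕ} (h : vol A = n) (hz : z ∈ A) : z ≤ n := by
  have := le_vol hz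
  rw [h] at this
  exact_mod_cast this

theorem exists_max_of_vol_eq {A : Set ℕ} {n : ℕ} (h : vol A = n) (hn : 0 < n) :
    ∃ m ∈ A, 0 < m ∧ A ⊆ Set.Iic m := by
  have hne : A.Nonempty := by
    by_contra h'
    rw [Set.not_nonempty_iff_eq_empty] at h'
    subst h'
    simp only [vol, tsum_empty] at h
    exact hn.ne (by exact_mod_cast h)
  have hfin : A.Finite := (Set.finite_Iic n).subset fun z hz => le_of_mem_of_vol_eq h hz
  obtain ⟨m, hm, hmax⟩ := hfin.exists_maximalFor id A hne
  have hsub : A ⊆ Set.Iic m := fun z hz => by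
    rcases le_total z m with h' | h'
    · exact h'
    · exact hmax hz h'
  refine ⟨m, hm, ?_, hsub⟩
  by_contra h0
  have := vol_mono hsub
  rw [vol_Iic, h, Nat.eq_zero_of_not_pos h0] at this
  have : n ≤ tri 0 := by exact_mod_cast this
  simp only [tri] at this
  omega

theorem vol_add_vol_compl {A : Set ℕ} {m : ℕ} (h : A ⊆ Set.Iic m) :
    vol A + vol (Set.Iic m \ A) = tri m := by
  rw [← vol_union Set.disjoint_sdiff_right, Set.union_sdiff_cancel h, vol_Iic]

/-- The complement in `Iic m` of a set of volume `n` has volume `tri m - n`. -/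
theorem vol_diff_of_vol_eq {A : Set ℕ} {m n : ℕ} (hA : A ⊆ Set.Iic m) (h : vol A = n) :
    n ≤ tri m ∧ vol (Set.Iic m \ A) = (tri m - n : ℕ) := by
  have hadd := vol_add_vol_compl hA
  rw [h] at hadd
  exact le_and_eq_sub_of_add_eq hadd

/-! ### Perimeters under complementation -/

theorem zero_mem_boundary {A : Set ℕ} : 0 ∈ boundary A ↔ 0 ∈ A := by
  simp [boundary]

theorem succ_mem_boundary {A : Set ℕ} {z : ℕ} :
    z + 1 ∈ boundary A ↔ z + 1 ∈ A ∧ ¬ (z ∈ A ∧ z + 2 ∈ A) := by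
  simp only [boundary, Set.mem_ofPred_eq, Nat.add_right_cancel_iff, exists_eq_right]

theorem max_mem_boundary {A : Set ℕ} {m : ℕ} (hm : m ∈ A) (hA : A ⊆ Set.Iic m) :
    m ∈ boundary A :=
  ⟨hm, fun h => by simpa using hA h.2⟩

/-- As `m ∈ A`, the complement splits into the ray from `m + 1`, whose only boundary point is `m +
1`, and a part below `m` not adjacent to it. -/
theorem per_compl {A : Set ℕ} {m : ℕ} (hm : m ∈ A) (hA : A ⊆ Set.Iic m) :
    per Aᶜ = (m + 1 : ℕ) + per (Set.Iic m \ A) := by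
  have h : boundary Aᶜ = {m + 1} ∪ boundary (Set.Iic m \ A) := by
    have hA' : ∀ z ∈ A, z ≤ m := hA
    ext z
    cases z with
    | zero =>
      simp [zero_mem_boundary]
    | succ z =>
      simp only [succ_mem_boundary, Set.mem_union, Set.mem_compl_iff, Set.mem_sdiff, Set.mem_Iic,
        Set.mem_singleton_iff]
      grind
  change vol _ = _ + vol _
  rw [h, vol_union, vol_singleton]
  rw [Set.disjoint_singleton_left]
  rintro ⟨h, -⟩
  simp at h

/-- Adjoining the ray above `m + 1` to `A` makes `m + 1` interior and affects no other boundary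
point. Were `m ∉ A`, then `m + 1` would remain a boundary point and be counted twice. -/
theorem per_eq_add_per_compl {A : Set ℕ} {m : ℕ} (hm : m + 1 ∈ A) (hm' : m ∈ A)
    (hA : A ⊆ Set.Iic (m + 1)) :
    per A = (m + 1 : ℕ) + per (Set.Iic (m + 1) \ A)ᶜ := by
  have hA' : ∀ z ∈ A, z ≤ m + 1 := hA
  have h : boundary A = {m + 1} ∪ boundary (Set.Iic (m + 1) \ A)ᶜ := by
    ext z
    cases z with
    | zero =>
      simp [zero_mem_boundary]
    | succ z =>
      simp only [succ_mem_boundary, Set.mem_union, Set.mem_compl_iff, Set.mem_sdiff, Set.mem_Iic,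
        Set.mem_singleton_iff]
      grind
  change vol _ = _ + vol _
  rw [h, vol_union, vol_singleton]
  rw [Set.disjoint_singleton_left, succ_mem_boundary]
  simp [hm, hm']

/-- Only an inequality: if `m - 1 ∈ B`, then `m` also lies in the boundary of `Bᶜ`. -/
theorem per_le_add_per_compl {B : Set ℕ} {m : ℕ} (hB : B ⊆ Set.Iio m) :
    per (Set.Iic m \ B) ≤ m + per Bᶜ := by
  have hB' : ∀ z ∈ B, z < m := hB
  have h : boundary (Set.Iic m \ B) ⊆ {m} ∪ boundary Bᶜ := by
    intro z
    cases z with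
    | zero =>
      simp only [zero_mem_boundary, Set.mem_union]
      intro h
      exact Or.inr h.2
    | succ z =>
      simp only [succ_mem_boundary, Set.mem_union, Set.mem_compl_iff, Set.mem_sdiff, Set.mem_Iic,
        Set.mem_singleton_iff]
      grind
  change vol _ ≤ _ + vol _
  rw [← vol_singleton m]
  exact (vol_mono h).trans (vol_union_le _ _)

theorem per_of_isolated_max {A : Set ℕ} {m : ℕ} (hm : m + 1 ∈ A) (hm' : m ∉ A)
    (hA : A ⊆ Set.Iic (m + 1)) :
    per A = (m + 1 : ℕ) + per (A \ {m + 1}) := by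
  have hA' : ∀ z ∈ A, z ≤ m + 1 := hA
  have h : boundary A = {m + 1} ∪ boundary (A \ {m + 1}) := by
    ext z
    cases z with
    | zero =>
      simp [zero_mem_boundary]
    | succ z =>
      simp only [succ_mem_boundary, Set.mem_union, Set.mem_sdiff, Set.mem_singleton_iff]
      grind
  change vol _ = _ + vol _
  rw [h, vol_union, vol_singleton]
  rw [Set.disjoint_singleton_left, succ_mem_boundary]
  simp

/-! ### The mutual recursion through the largest element -/

theorem P_le {A : Set ℕ} {n k : ℕ} (hA : vol A = n) (hk : per A ≤ k) : P n ≤ k := by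
  have hfin : (boundary A).Finite := (Set.finite_Iic n).subset fun z hz =>
    le_of_mem_of_vol_eq hA hz.1
  obtain ⟨i, hi⟩ := exists_nat_of_finite hfin
  have hi' : per A = i := hi
  rw [hi'] at hk
  exact ((isLeast_P n).2 ⟨A, hA, hi'⟩).trans (by exact_mod_cast hk)

theorem Q_le {A : Set ℕ} {n k : ℕ} (hA : vol A = n) (hk : per Aᶜ ≤ k) : Q n ≤ k := by
  have hfin : (boundary Aᶜ).Finite := (Set.finite_Iic k).subset fun z hz => by
    have := (le_vol hz).trans hk
    exact_mod_cast this
  obtain ⟨i, hi⟩ := exists_nat_of_finite hfin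
  have hi' : per Aᶜ = i := hi
  rw [hi'] at hk
  exact ((isLeast_Q n).2 ⟨A, hA, hi'⟩).trans (by exact_mod_cast hk)

theorem exists_vol_per (n : ℕ) : ∃ A : Set ℕ, vol A = n ∧ per A = P n := (isLeast_P n).1

theorem exists_vol_per_compl (n : ℕ) : ∃ A : Set ℕ, vol A = n ∧ per Aᶜ = Q n := (isLeast_Q n).1

/-- Decomposition of a minimiser of `P` by its largest element `m`, according to whether
`m` is isolated. -/
theorem exists_le_P {n : ℕ} (hn : 0 < n) :
    ∃ m, n ≤ tri m ∧ ((m ≤ n ∧ m + P (n - m) ≤ P n) ∨ m + Q (tri m - n) ≤ P n) := by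
  obtain ⟨A, hv, hp⟩ := exists_vol_per n
  obtain ⟨m, hm, hm0, hA⟩ := exists_max_of_vol_eq hv hn
  obtain ⟨m, rfl⟩ := Nat.exists_eq_add_one_of_ne_zero hm0.ne'
  obtain ⟨hle, hvol⟩ := vol_diff_of_vol_eq hA hv
  refine ⟨m + 1, hle, ?_⟩
  by_cases hm' : m ∈ A
  · right
    rw [per_eq_add_per_compl hm hm' hA] at hp
    obtain ⟨h1, h2⟩ := le_and_eq_sub_of_add_eq hp
    have := Q_le hvol h2.le
    omega
  · left
    have hmn := le_of_mem_of_vol_eq hv hm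
    refine ⟨hmn, ?_⟩
    rw [per_of_isolated_max hm hm' hA] at hp
    obtain ⟨h1, h2⟩ := le_and_eq_sub_of_add_eq hp
    have h3 : vol (A \ {m + 1}) = (n - (m + 1) : ℕ) := by
      have : vol A = vol {m + 1} + vol (A \ {m + 1}) := by
        rw [← vol_union Set.disjoint_sdiff_right, Set.union_sdiff_cancel (by simpa using hm)]
      rw [hv, vol_singleton] at this
      exact (le_and_eq_sub_of_add_eq this.symm).2
    have := P_le h3 h2.le
    omega

/-- Decomposition of a minimiser of `Q` by its largest element `m`. -/
theorem exists_le_Q {n : ℕ} (hn : 0 < n) :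
    ∃ m, n ≤ tri m ∧ m + 1 + P (tri m - n) ≤ Q n := by
  obtain ⟨A, hv, hp⟩ := exists_vol_per_compl n
  obtain ⟨m, hm, -, hA⟩ := exists_max_of_vol_eq hv hn
  obtain ⟨hle, hvol⟩ := vol_diff_of_vol_eq hA hv
  refine ⟨m, hle, ?_⟩
  rw [per_compl hm hA] at hp
  obtain ⟨h1, h2⟩ := le_and_eq_sub_of_add_eq hp
  have := P_le hvol h2.le
  omega

/-- Either alternative in `hw` keeps an optimal `B` below `m`: elements of `B` are at most `w`, and
`max B + 1` is a boundary point of `Bᶜ`, hence at most `Q w`. -/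
theorem P_le_add_Q {m n w : ℕ} (h : n + w = tri m) (hw : w < m ∨ Q w ≤ m) :
    P n ≤ m + Q w := by
  obtain ⟨B, hv, hp⟩ := exists_vol_per_compl w
  have hB : B ⊆ Set.Iio m ∨ m = 0 := by
    by_cases hw' : w < m
    · exact Or.inl fun z hz => (le_of_mem_of_vol_eq hv hz).trans_lt hw'
    · rcases Nat.eq_zero_or_pos w with rfl | hw0
      · right
        omega
      · left
        obtain ⟨k, hk, -, hBk⟩ := exists_max_of_vol_eq hv hw0
        rw [per_compl hk hBk] at hp
        have h1 := (le_and_eq_sub_of_add_eq hp).1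
        intro z hz
        have : z ≤ k := hBk hz
        simp only [Set.mem_Iio]
        omega
  rcases hB with hB | rfl
  · obtain ⟨-, hvol⟩ := vol_diff_of_vol_eq (hB.trans fun z hz => (Set.mem_Iio.1 hz).le) hv
    rw [← h, Nat.add_sub_cancel] at hvol
    refine P_le hvol ((per_le_add_per_compl hB).trans ?_)
    rw [hp]
    push_cast
    rfl
  · have : n = 0 := by simp [tri] at h; omega
    subst this
    refine (P_le (A := {0}) (vol_singleton 0) (k := 0) ?_).trans (Nat.zero_le _)
    exact (vol_mono fun z hz => hz.1).trans (vol_singleton 0).le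

theorem Q_le_add_P {m n w : ℕ} (h : n + w = tri m) (hw : w < m ∨ P w < m) :
    Q n ≤ m + 1 + P w := by
  obtain ⟨B, hv, hp⟩ := exists_vol_per w
  have hm0 : 0 < m := by omega
  have hB : B ⊆ Set.Iio m := by
    by_cases hw' : w < m
    · exact fun z hz => (le_of_mem_of_vol_eq hv hz).trans_lt hw'
    · obtain ⟨k, hk, -, hBk⟩ := exists_max_of_vol_eq hv (by omega)
      have h1 : k ≤ P w := by
        have := le_vol (max_mem_boundary hk hBk)
        have : (k : ℝ≥0∞) ≤ P w := hp ▸ this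
        exact_mod_cast this
      intro z hz
      have : z ≤ k := hBk hz
      simp only [Set.mem_Iio]
      omega
  have hB' : B ⊆ Set.Iic m := hB.trans fun z hz => (Set.mem_Iio.1 hz).le
  obtain ⟨-, hvol⟩ := vol_diff_of_vol_eq hB' hv
  rw [← h, Nat.add_sub_cancel] at hvol
  refine Q_le hvol ?_
  have hm : m ∈ Set.Iic m \ B := ⟨Set.self_mem_Iic, fun hm => lt_irrefl m (hB hm)⟩
  rw [per_compl hm Set.sdiff_subset, Set.sdiff_sdiff_cancel_left hB', hp]
  push_cast
  rfl

theorem P_tri_add_le {a b : ℕ} (h : a < b) : P (tri a + b) ≤ a + b := by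
  have hv : vol (Set.Iic a ∪ {b}) = (tri a + b : ℕ) := by
    rw [vol_union (by simpa using h), vol_Iic, vol_singleton]
    push_cast
    rfl
  refine P_le hv ?_
  have hsub : boundary (Set.Iic a ∪ {b}) ⊆ {0} ∪ ({a} ∪ {b}) := by
    intro z
    cases z with
    | zero => simp
    | succ z =>
      simp only [succ_mem_boundary, Set.mem_union, Set.mem_Iic, Set.mem_singleton_iff]
      omega
  calc per (Set.Iic a ∪ {b}) ≤ vol ({0} ∪ ({a} ∪ {b})) := vol_mono hsub
    _ ≤ vol {0} + (vol {a} + vol {b}) :=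
        (vol_union_le _ _).trans (add_le_add le_rfl (vol_union_le _ _))
    _ = (a + b : ℕ) := by
        simp only [vol_singleton]
        push_cast
        simp

/-! ### The functions `f` and `gap` -/

/-- `√(2n) < m + 1/2` means `2n < m(m + 1) + 1/4`, and both `2n` and `m(m + 1)` are integers. -/
theorem f_le_iff {n m : ℕ} : f n ≤ m ↔ n ≤ tri m := by
  have htri := two_mul_tri m
  rw [← Nat.lt_add_one_iff, f, Nat.floor_lt (by positivity)]
  push_cast
  rw [show (√(2 * (n : ℝ)) + 1 / 2 < m + 1 ↔ √(2 * (n : ℝ)) < m + 1 / 2) by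
    constructor <;> intro h <;> linarith, Real.sqrt_lt' (by positivity)]
  constructor
  · intro h
    by_contra! h'
    have h1 : m * (m + 1) + 2 ≤ 2 * n := by omega
    have h2 : (m * (m + 1) + 2 : ℝ) ≤ 2 * n := by exact_mod_cast h1
    nlinarith
  · intro h
    have h1 : 2 * n ≤ m * (m + 1) := by omega
    have h2 : (2 * n : ℝ) ≤ m * (m + 1) := by exact_mod_cast h1
    nlinarith

theorem lt_f_iff {n m : ℕ} : m < f n ↔ tri m < n := by
  rw [← not_le, f_le_iff, not_le]

theorem f_mono : Monotone f := fun _ _ h => f_le_iff.2 (h.trans (f_le_iff.1 le_rfl))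

theorem f_succ_le (n : ℕ) : f (n + 1) ≤ f n + 1 := by
  have := f_le_iff.1 (le_refl (f n))
  rw [f_le_iff, tri_succ]
  omega

theorem f_pos {n : ℕ} (hn : 0 < n) : 0 < f n := lt_f_iff.2 hn

/-- The value of `g n` as a natural number. -/
noncomputable def gap (n : ℕ) : ℕ := tri (f n) - n

theorem add_gap (n : ℕ) : n + gap n = tri (f n) :=
  Nat.add_sub_cancel' (f_le_iff.1 le_rfl)

theorem g_eq_gap (n : ℕ) : g n = gap n := by
  have h1 := two_mul_tri (f n)
  have h2 := add_gap n
  zify at h1 h2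
  unfold g
  omega

theorem gap_lt {n : ℕ} (hn : 0 < n) : gap n < f n := by
  have h1 := f_pos hn
  have h2 := lt_f_iff.1 (Nat.sub_lt h1 one_pos)
  have h3 := tri_succ (f n - 1)
  rw [Nat.sub_add_cancel h1] at h3
  have := add_gap n
  omega

theorem f_eq_and_gap_eq {n m w : ℕ} (h : n + w = tri m) (hw : w < m) : f n = m ∧ gap n = w := by
  have hf : f n = m := by
    refine le_antisymm (f_le_iff.2 (by omega)) ?_
    obtain ⟨k, rfl⟩ := Nat.exists_eq_add_one_of_ne_zero (by omega : m ≠ 0)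
    rw [tri_succ] at h
    exact lt_f_iff.2 (by omega)
  refine ⟨hf, ?_⟩
  have := add_gap n
  rw [hf] at this
  omega

theorem tri_f_add_one (n : ℕ) : tri (f n + 1) = n + (gap n + f n + 1) := by
  rw [tri_succ, ← add_gap]
  omega

theorem tri_f_add_two (n : ℕ) : tri (f n + 2) = n + (gap n + 2 * f n + 3) := by
  rw [tri_succ, tri_f_add_one]
  omega

/-! ### Bounds for `P` and `Q` from the recursion -/

theorem f_le_P (n : ℕ) : f n ≤ P n := by
  rcases Nat.eq_zero_or_pos n with rfl | hn
  · exact (f_le_iff.2 le_rfl).trans (Nat.zero_le _)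
  · obtain ⟨m, hm, h⟩ := exists_le_P hn
    have := f_le_iff.2 hm
    omega

theorem f_lt_Q {n : ℕ} (hn : 0 < n) : f n < Q n := by
  obtain ⟨m, hm, h⟩ := exists_le_Q hn
  have := f_le_iff.2 hm
  omega

/-- `f` grows by at most one per step. Hence, among isolated maxima `m ≥ f n`, the lower bound `m +
f (n - m)` is smallest at `m = f n`. -/
theorem add_f_sub_mono {n a b : ℕ} (h : a ≤ b) : a + f (n - a) ≤ b + f (n - b) := by
  induction b, h using Nat.le_induction with
  | base => rfl
  | succ b hb ih =>
    have h1 := f_succ_le (n - (b + 1))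
    have h2 : f (n - b) ≤ f (n - (b + 1) + 1) := f_mono (by omega)
    omega

/-- A minimiser of `P` has an isolated maximum, or its maximum is `f n`, `f n + 1` or larger. -/
theorem P_ge {n : ℕ} (hn : 0 < n) :
    f n + f (n - f n) ≤ P n ∨ f n + Q (gap n) ≤ P n ∨ f n + 1 + Q (gap n + f n + 1) ≤ P n ∨
      f n + 3 + f (gap n + 2 * f n + 3) ≤ P n := by
  obtain ⟨m, hm, ⟨hmn, h⟩ | h⟩ := exists_le_P hn
  · have h1 := add_f_sub_mono (n := n) (f_le_iff.2 hm)
    have h2 := f_le_P (n - m)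
    omega
  · have hfm := f_le_iff.2 hm
    rcases hfm.eq_or_lt with rfl | hfm
    · exact Or.inr (Or.inl h)
    rcases (Nat.succ_le_of_lt hfm).eq_or_lt with rfl | hfm
    · rw [Nat.succ_eq_add_one, tri_f_add_one, Nat.add_sub_cancel_left] at h
      exact Or.inr (Or.inr (Or.inl h))
    · have h1 := tri_strictMono.monotone (Nat.succ_le_of_lt hfm)
      rw [Nat.succ_eq_add_one, add_assoc, tri_f_add_two] at h1
      have h2 := f_lt_Q (n := tri m - n) (by omega)
      have h3 := f_mono (by omega : gap n + 2 * f n + 3 ≤ tri m - n)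
      omega

/-- The maximum of a minimiser of `Q` is `f n`, `f n + 1` or larger. -/
theorem Q_ge {n : ℕ} (hn : 0 < n) :
    f n + 1 + P (gap n) ≤ Q n ∨ f n + 2 + P (gap n + f n + 1) ≤ Q n ∨
      f n + 3 + f (gap n + 2 * f n + 3) ≤ Q n := by
  obtain ⟨m, hm, h⟩ := exists_le_Q hn
  have hfm := f_le_iff.2 hm
  rcases hfm.eq_or_lt with rfl | hfm
  · exact Or.inl h
  rcases (Nat.succ_le_of_lt hfm).eq_or_lt with rfl | hfm
  · rw [Nat.succ_eq_add_one, tri_f_add_one, Nat.add_sub_cancel_left] at h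
    exact Or.inr (Or.inl h)
  · have h1 := tri_strictMono.monotone (Nat.succ_le_of_lt hfm)
    rw [Nat.succ_eq_add_one, add_assoc, tri_f_add_two] at h1
    have h2 := f_le_P (tri m - n)
    have h3 := f_mono (by omega : gap n + 2 * f n + 3 ≤ tri m - n)
    omega

theorem P_le_f_add {n : ℕ} (hn : 0 < n) : P n ≤ f n + Q (gap n) :=
  P_le_add_Q (add_gap n) (Or.inl (gap_lt hn))

theorem Q_le_f_add {n : ℕ} (hn : 0 < n) : Q n ≤ f n + 1 + P (gap n) :=
  Q_le_add_P (add_gap n) (Or.inl (gap_lt hn))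

theorem P_le_f_add_one_add {n : ℕ} (h : Q (gap n + f n + 1) ≤ f n + 1) :
    P n ≤ f n + 1 + Q (gap n + f n + 1) :=
  P_le_add_Q (tri_f_add_one n).symm (Or.inr h)

theorem Q_le_f_add_one_add {n : ℕ} (h : P (gap n + f n + 1) ≤ f n) :
    Q n ≤ f n + 2 + P (gap n + f n + 1) :=
  Q_le_add_P (tri_f_add_one n).symm (Or.inr (Nat.lt_add_one_iff.2 h))

theorem P_le_of_isolated {n a : ℕ} (h : tri a + a < n) : P n ≤ n + a - tri a := by
  have := P_tri_add_le (a := a) (b := n - tri a) (by omega)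
  rw [Nat.add_sub_cancel' (by omega)] at this
  omega

theorem P_le_self (n : ℕ) : P n ≤ n := by
  rcases Nat.eq_zero_or_pos n with rfl | hn
  · exact P_le (A := {0}) (vol_singleton 0) ((vol_mono fun z hz => hz.1).trans (vol_singleton 0).le)
  · simpa [tri] using P_le_of_isolated (a := 0) (n := n) (by simpa [tri] using hn)

theorem Q_zero : Q 0 = 0 := by
  have hv : vol ∅ = (0 : ℕ) := by simp [vol]
  refine Nat.le_zero.1 (Q_le hv ?_)
  have h : boundary ∅ᶜ ⊆ {0} := by
    intro z
    cases z <;> simp [succ_mem_boundary]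
  exact (vol_mono h).trans (vol_singleton 0).le

/-! ### Evaluation of `f` and of the recursions for `P` and `Q` -/

/-- Binary search for `f n`, correct for `f n < 128`. -/
def triRoot (n : ℕ) : ℕ :=
  [64, 32, 16, 8, 4, 2, 1].foldl (fun m b => if tri (m + b - 1) < n then m + b else m) 0

theorem triRoot_le (n : ℕ) : triRoot n ≤ f n := by
  have key : ∀ (l : List ℕ) (m : ℕ), m ≤ f n → (∀ b ∈ l, 0 < b) →
      l.foldl (fun m b => if tri (m + b - 1) < n then m + b else m) m ≤ f n := by
    intro l
    induction l with
    | nil => exact fun m hm _ => hm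
    | cons b l ih =>
      intro m hm hl
      rw [List.foldl_cons]
      refine ih _ ?_ fun c hc => hl c (List.mem_cons_of_mem _ hc)
      split_ifs with h
      · have := lt_f_iff.2 h
        omega
      · exact hm
  exact key _ 0 (Nat.zero_le _) (by simp)

theorem triRoot_eq {n : ℕ} (hn : n ≤ 8128) : triRoot n = f n := by
  have h : f n ≤ 127 := f_le_iff.2 hn
  simp only [triRoot, List.foldl_cons, List.foldl_nil, ← lt_f_iff]
  generalize f n = F at h ⊢
  interval_cases F <;> rfl

/-- `p` and `q` are lower bounds for `P` and `Q` up to `8128`. -/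
def IsLower (p q : ℕ → ℕ) : Prop := ∀ n ≤ 8128, p n ≤ P n ∧ q n ≤ Q n

/-- `p` and `q` are upper bounds for `P` and `Q` up to `8128`. -/
def IsUpper (p q : ℕ → ℕ) : Prop := ∀ n ≤ 8128, P n ≤ p n ∧ Q n ≤ q n

/-- The lower bound for `P` obtained from one for `Q`. -/
def lowerP (q : ℕ → ℕ) (n : ℕ) : ℕ :=
  let F := triRoot n
  let G := tri F - n
  if n = 0 then 0 else
    min (min (F + triRoot (n - F)) (F + q G))
      (min (F + 1 + q (G + F + 1)) (F + 3 + triRoot (G + 2 * F + 3)))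

/-- The lower bound for `Q` obtained from one for `P`. -/
def lowerQ (p : ℕ → ℕ) (n : ℕ) : ℕ :=
  let F := triRoot n
  let G := tri F - n
  if n = 0 then 0 else
    min (F + 1 + p G) (min (F + 2 + p (G + F + 1)) (F + 3 + triRoot (G + 2 * F + 3)))

/-- The upper bound for `P` obtained from one for `Q`. -/
def upperP (q : ℕ → ℕ) (n : ℕ) : ℕ :=
  let F := triRoot n
  let G := tri F - n
  if n = 0 then 0 else
    min (F + q G)
      (min (if q (G + F + 1) ≤ F + 1 then F + 1 + q (G + F + 1) else n)
        -- The set `{0, …, F - 2} ∪ {n - tri (F - 2)}`, a candidate with isolated maximum.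
        (if tri (F - 2) + (F - 2) < n then n + (F - 2) - tri (F - 2) else n))

/-- The upper bound for `Q` obtained from one for `P`. -/
def upperQ (p : ℕ → ℕ) (n : ℕ) : ℕ :=
  let F := triRoot n
  let G := tri F - n
  if n = 0 then 0 else
    min (F + 1 + p G) (if p (G + F + 1) ≤ F then F + 2 + p (G + F + 1) else F + 1 + p G)

/-- The range up to `8128 = tri 127`, where `triRoot` is exact, is closed under the recursion. -/
theorem gap_add_f_le {n : ℕ} (hn : n ≤ 8128) : gap n + f n + 1 ≤ 8128 := by
  have h : f n ≤ 127 := f_le_iff.2 hn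
  rcases Nat.eq_zero_or_pos n with rfl | hn
  · have := add_gap 0
    have := f_le 0
    simp_all [tri]
  · have := gap_lt hn
    omega

theorem IsLower.step {p q : ℕ → ℕ} (h : IsLower p q) : IsLower (lowerP q) (lowerQ p) := by
  intro n hn
  have hw := gap_add_f_le hn
  obtain ⟨hp1, hq1⟩ := h (gap n) (by omega)
  obtain ⟨hp2, hq2⟩ := h _ hw
  have h3 := triRoot_le (gap n + 2 * f n + 3)
  have h4 := triRoot_le (n - f n)
  simp only [lowerP, lowerQ, triRoot_eq hn]
  change (if n = 0 then 0 else min (min _ (f n + q (gap n))) (min (f n + 1 + q (gap n + f n + 1))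
    (f n + 3 + triRoot (gap n + 2 * f n + 3)))) ≤ P n ∧
    (if n = 0 then 0 else min (f n + 1 + p (gap n)) (min (f n + 2 + p (gap n + f n + 1))
    (f n + 3 + triRoot (gap n + 2 * f n + 3)))) ≤ Q n
  split_ifs with h0
  · exact ⟨Nat.zero_le _, Nat.zero_le _⟩
  · have hP := P_ge (Nat.pos_of_ne_zero h0)
    have hQ := Q_ge (Nat.pos_of_ne_zero h0)
    omega

theorem IsUpper.step {p q : ℕ → ℕ} (h : IsUpper p q) : IsUpper (upperP q) (upperQ p) := by
  intro n hn
  have hw := gap_add_f_le hn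
  obtain ⟨hp1, hq1⟩ := h (gap n) (by omega)
  obtain ⟨hp2, hq2⟩ := h _ hw
  simp only [upperP, upperQ, triRoot_eq hn]
  change P n ≤ (if n = 0 then 0 else min (f n + q (gap n))
    (min (if q (gap n + f n + 1) ≤ f n + 1 then f n + 1 + q (gap n + f n + 1) else n) _)) ∧
    Q n ≤ (if n = 0 then 0 else min (f n + 1 + p (gap n))
    (if p (gap n + f n + 1) ≤ f n then f n + 2 + p (gap n + f n + 1) else f n + 1 + p (gap n)))
  by_cases h0 : n = 0
  · subst h0
    exact ⟨P_le_self 0, Q_zero.le⟩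
  · rw [if_neg h0, if_neg h0]
    have hP := P_le_f_add (Nat.pos_of_ne_zero h0)
    have hQ := Q_le_f_add (Nat.pos_of_ne_zero h0)
    have hP' := P_le_f_add_one_add (n := n)
    have hQ' := Q_le_f_add_one_add (n := n)
    have hi := P_le_of_isolated (n := n) (a := f n - 2)
    have hs := P_le_self n
    constructor
    · refine le_min (by omega) (le_min ?_ ?_)
      · split_ifs <;> omega
      · split_ifs <;> omega
    · refine le_min (by omega) ?_
      split_ifs <;> omega

def lowerIter (d : ℕ) : (ℕ → ℕ) × (ℕ → ℕ) :=
  (fun r => (lowerP r.2, lowerQ r.1))^[d] (triRoot, triRoot)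

def upperIter (d : ℕ) : (ℕ → ℕ) × (ℕ → ℕ) :=
  (fun r => (upperP r.2, upperQ r.1))^[d] (id, fun n => 2 * n)

theorem isLower_lowerIter (d : ℕ) : IsLower (lowerIter d).1 (lowerIter d).2 := by
  induction d with
  | zero =>
    intro n _
    have h1 := triRoot_le n
    have h2 := f_le_P n
    refine ⟨h1.trans h2, ?_⟩
    rcases Nat.eq_zero_or_pos n with rfl | hn
    · exact h1.trans ((f_le 0).trans (Nat.zero_le _))
    · exact h1.trans (f_lt_Q hn).le
  | succ d ih =>
    rw [lowerIter, Function.iterate_succ_apply']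
    exact ih.step

theorem isUpper_upperIter (d : ℕ) : IsUpper (upperIter d).1 (upperIter d).2 := by
  induction d with
  | zero =>
    intro n _
    refine ⟨P_le_self n, ?_⟩
    rcases Nat.eq_zero_or_pos n with rfl | hn
    · exact Q_zero.le
    · have h1 := Q_le_f_add hn
      have h2 := P_le_self (gap n)
      have h3 := gap_lt hn
      have h4 := f_le n
      change Q n ≤ 2 * n
      omega
  | succ d ih =>
    rw [upperIter, Function.iterate_succ_apply']
    exact ih.step

/-! ### The values for `n ≤ 92` -/

def valuesP : List ℕ :=
  [0, 1, 2, 2, 4, 5, 3, 6, 7, 6, 4, 8, 8, 9, 7, 5, 10, 11, 9, 10, 8, 6, 11, 12, 13, 10, 11, 9,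
   7, 14, 12, 13, 14, 11, 12, 10, 8, 16, 16, 13, 14, 15, 12, 13, 11, 9, 16, 17, 17, 14, 15, 16,
   13, 14, 12, 10, 16, 17, 18, 18, 15, 16, 17, 14, 15, 13, 11, 22, 17, 18, 19, 19, 16, 17, 18,
   15, 16, 14, 12, 21, 23, 18, 19, 20, 20, 17, 18, 19, 16, 17, 15, 13, 22]

def valuesQ : List ℕ :=
  [0, 2, 4, 3, 6, 5, 4, 7, 7, 6, 5, 10, 8, 8, 7, 6, 12, 11, 9, 9, 8, 7, 11, 13, 12, 10, 10, 9,
   8, 15, 12, 14, 13, 11, 11, 10, 9, 17, 16, 13, 15, 14, 12, 12, 11, 10, 17, 18, 17, 14, 16, 15,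
   13, 13, 12, 11, 16, 18, 19, 18, 15, 17, 16, 14, 14, 13, 12, 21, 17, 19, 20, 19, 16, 18, 17,
   15, 15, 14, 13, 22, 22, 18, 20, 21, 20, 17, 19, 18, 16, 16, 15, 14, 23]

/-- After four rounds the lower and upper bounds meet, so the tables hold the exact values. -/
theorem values_le_lowerIter : ∀ n < 93,
    valuesP.getD n 0 ≤ (lowerIter 4).1 n ∧ valuesQ.getD n 0 ≤ (lowerIter 4).2 n := by
  decide +kernel

theorem upperIter_le_values : ∀ n < 93,
    (upperIter 4).1 n ≤ valuesP.getD n n ∧ (upperIter 4).2 n ≤ valuesQ.getD n (2 * n) := by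
  decide +kernel

theorem isLower_values : IsLower (valuesP.getD · 0) (valuesQ.getD · 0) := by
  intro n hn
  by_cases h : n < 93
  · have h1 := isLower_lowerIter 4 n hn
    have h2 := values_le_lowerIter n h
    exact ⟨h2.1.trans h1.1, h2.2.trans h1.2⟩
  -- Past the table the default `0` is a trivial lower bound.
  · beta_reduce
    rw [List.getD_eq_default _ _ (not_lt.1 h), List.getD_eq_default _ _ (not_lt.1 h)]
    exact ⟨Nat.zero_le _, Nat.zero_le _⟩

theorem isUpper_values : IsUpper (fun n => valuesP.getD n n) (fun n => valuesQ.getD n (2 * n)) := by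
  intro n hn
  by_cases h : n < 93
  · have h1 := isUpper_upperIter 4 n hn
    have h2 := upperIter_le_values n h
    exact ⟨h1.1.trans h2.1, h1.2.trans h2.2⟩
  · beta_reduce
    rw [List.getD_eq_default _ _ (not_lt.1 h), List.getD_eq_default _ _ (not_lt.1 h)]
    exact isUpper_upperIter 0 n hn

/-! ### Comparison of consecutive choices of the maximum -/

/-- A linear upper bound for `P` and `Q`. -/
theorem five_mul_le (n : ℕ) : 5 * P n ≤ n + 48 ∧ 5 * Q n ≤ n + 48 := by
  induction n using Nat.strong_induction_on with
  | _ n ih =>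
    by_cases h : n < 93
    -- The constant 48 is forced by `Q 37 = 17`.
    · have hcheck : ∀ n < 93,
          5 * valuesP.getD n n ≤ n + 48 ∧ 5 * valuesQ.getD n (2 * n) ≤ n + 48 := by
        decide +kernel
      have h1 := isUpper_values n (by omega)
      have h2 := hcheck n h
      dsimp only at h1
      omega
    · have hn : 0 < n := by omega
      have h1 := P_le_f_add hn
      have h2 := Q_le_f_add hn
      have h3 := gap_lt hn
      have h4 := ih (gap n) (h3.trans_le (f_le n))
      have h5 : 13 < f n := lt_f_iff.2 (by simp only [tri]; omega)
      have h6 : tri (f n - 1) < n := lt_f_iff.1 (by omega)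
      have h7 := two_mul_tri (f n - 1)
      obtain ⟨k, hk⟩ := Nat.exists_eq_add_of_le' h5
      rw [hk] at h1 h2 h3 h6 h7
      rw [show k + (13 + 1) - 1 = k + 13 by omega] at h6 h7
      -- With `gap n ≤ f n - 1`, the induction hypothesis gives at most `6 * f n + 52` for both `5 *
      -- P n` and `5 * Q n`.
      have h8 : 6 * (k + 14) + 4 ≤ n := by nlinarith
      omega

/-- `f (2 * n + 2)` is about `√2 * f n`, which beats `6/5 * f n` plus a constant once `f n ≥ 44`,
that is, once `n > tri 43 = 946`. -/
theorem P_Q_le_of_large {n : ℕ} (hn : 947 ≤ n) :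
    P n ≤ 1 + f (2 * n + 2) ∧ Q n ≤ 2 + f (2 * n + 2) := by
  have hn0 : 0 < n := by omega
  have h1 := P_le_f_add hn0
  have h2 := Q_le_f_add hn0
  have h3 := gap_lt hn0
  have h4 := five_mul_le (gap n)
  have h5 : 43 < f n := lt_f_iff.2 (by simp only [tri]; omega)
  have h6 : tri (f n - 1) < n := lt_f_iff.1 (by omega)
  have h7 := two_mul_tri (f n - 1)
  have h8 : 2 * n + 2 ≤ tri (f (2 * n + 2)) := f_le_iff.1 le_rfl
  have h9 := two_mul_tri (f (2 * n + 2))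
  have key : 6 * f n + 42 ≤ 5 * f (2 * n + 2) := by
    generalize f (2 * n + 2) = H at *
    obtain ⟨k, hk⟩ := Nat.exists_eq_add_of_le' h5
    rw [hk] at h6 h7 ⊢
    rw [show k + (43 + 1) - 1 = k + 43 by omega] at h6 h7
    by_contra! hlt
    nlinarith
  omega

/-- The inequalities excluding a maximum other than `f n`, checked for all `n` with `gap n = G`. -/
def checkGap (G : ℕ) : Bool :=
  let U := upperP (fun n => valuesQ.getD n (2 * n)) G
  let V := upperQ (fun n => valuesP.getD n n) G
  decide (U ≤ 2 + triRoot (3 * G + 5)) && decide (V ≤ 3 + triRoot (3 * G + 5)) &&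
    -- Here `w` stands for `G + F + 1`. Beyond `tri (U - 2)` and `tri (V - 3)` the bounds `P w ≥ f
    -- w` and `Q w ≥ f w + 1` already suffice, so finitely many `w` remain.
    (List.range' (2 * G + 2) (max (tri (U - 2)) (tri (V - 3)) + 1 - (2 * G + 2))).all fun w =>
      (decide (U ≤ 1 + lowerP (valuesQ.getD · 0) w) &&
        decide (V ≤ 1 + lowerQ (valuesP.getD · 0) w)) ||
      -- This recovers `n = tri F - G` from `w`.
      decide (tri (w - G - 1) - G ∈ exceptions)

theorem checkGap_eq_true : ∀ G < 947, checkGap G = true := by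
  decide +kernel

theorem P_Q_gap_le {n : ℕ} (hn : 0 < n) (hE : n ∉ exceptions) :
    P (gap n) ≤ 1 + P (gap n + f n + 1) ∧ Q (gap n) ≤ 1 + Q (gap n + f n + 1) ∧
      P (gap n) ≤ 2 + f (gap n + 2 * f n + 3) ∧ Q (gap n) ≤ 3 + f (gap n + 2 * f n + 3) := by
  have hG := gap_lt hn
  have hfP := f_le_P (gap n + f n + 1)
  have hfQ := f_lt_Q (n := gap n + f n + 1) (by omega)
  have hf : f (gap n + f n + 1) ≤ f (gap n + 2 * f n + 3) := f_mono (by omega)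
  by_cases hlarge : 947 ≤ gap n
  · have h1 := P_Q_le_of_large hlarge
    have h2 : f (2 * gap n + 2) ≤ f (gap n + f n + 1) := f_mono (by omega)
    omega
  have hcheck := checkGap_eq_true (gap n) (by omega)
  obtain ⟨hU, hV⟩ := isUpper_values.step (gap n) (by omega)
  simp only [checkGap, Bool.and_eq_true, decide_eq_true_eq, List.all_eq_true, Bool.or_eq_true,
    List.mem_range'_1] at hcheck
  obtain ⟨⟨hP2, hQ2⟩, hall⟩ := hcheck
  have hr := (triRoot_le (3 * gap n + 5)).trans
    (f_mono (by omega : 3 * gap n + 5 ≤ gap n + 2 * f n + 3))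
  specialize hall (gap n + f n + 1)
  have hexc : tri (gap n + f n + 1 - gap n - 1) - gap n = n := by
    rw [show gap n + f n + 1 - gap n - 1 = f n by omega, ← add_gap, Nat.add_sub_cancel]
  rw [hexc] at hall
  generalize upperP _ _ = U at *
  generalize upperQ _ _ = V at *
  suffices P (gap n) ≤ 1 + P (gap n + f n + 1) ∧ Q (gap n) ≤ 1 + Q (gap n + f n + 1) by omega
  by_cases hw : gap n + f n + 1 ≤ max (tri (U - 2)) (tri (V - 3))
  · have hlow := hall (by omega)
    obtain ⟨h1, h2⟩ := hlow.resolve_right hE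
    have h127 : triRoot (3 * gap n + 5) ≤ 127 :=
      (triRoot_le _).trans (f_le_iff.2 (by simp only [tri]; omega))
    -- The first two checks give `U ≤ 129` and `V ≤ 130`, so `w` stays in the range of the tabulated
    -- bounds.
    have hw' : gap n + f n + 1 ≤ tri 127 := hw.trans (max_le
      (tri_strictMono.monotone (by omega)) (tri_strictMono.monotone (by omega)))
    obtain ⟨h3, h4⟩ := isLower_values.step _ hw'
    exact ⟨hU.trans (h1.trans (Nat.add_le_add_left h3 1)),
      hV.trans (h2.trans (Nat.add_le_add_left h4 1))⟩
  · rw [not_le, max_lt_iff, ← lt_f_iff, ← lt_f_iff] at hw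
    omega

theorem Q_le_values {n : ℕ} (hn : n < 93) : Q n ≤ valuesQ.getD n 0 := by
  have h := (isUpper_values n (by omega)).2
  beta_reduce at h
  have hlen : n < valuesQ.length := hn
  rwa [List.getD_eq_getElem _ _ hlen, ← List.getD_eq_getElem _ 0 hlen] at h

/-- Makes an isolated maximum no better than `m = f n`. For `f n ≥ 15` the linear bound gives `5 * Q
(gap n) ≤ f n + 47 ≤ 5 * (f n - 2)`, and `f (n - f n) ≥ f n - 2`. -/
theorem Q_gap_le_f_sub {n : ℕ} (hn : 0 < n) (hE : n ∉ exceptions) : Q (gap n) ≤ f (n - f n) := by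
  have hG := gap_lt hn
  by_cases h : n < 106
  · have hcheck : ∀ n < 106, 0 < n → n ∉ exceptions →
        valuesQ.getD (tri (triRoot n) - n) 0 ≤ triRoot (n - triRoot n) := by
      decide +kernel
    have h1 := hcheck n h hn hE
    have h2 : f n ≤ 14 := f_le_iff.2 (by simp only [tri]; omega)
    rw [triRoot_eq (by omega)] at h1
    change valuesQ.getD (gap n) 0 ≤ _ at h1
    exact ((Q_le_values (by omega)).trans h1).trans (triRoot_le _)
  · have h1 := (five_mul_le (gap n)).2
    have h2 : 14 < f n := lt_f_iff.2 (by simp only [tri]; omega)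
    have h3 : f n - 3 < f (n - f n) := by
      have h4 : tri (f n - 1) < n := lt_f_iff.1 (by omega)
      have h5 := tri_succ (f n - 3)
      have h6 := tri_succ (f n - 3 + 1)
      rw [show f n - 3 + 1 + 1 = f n - 1 by omega] at h6
      rw [lt_f_iff]
      omega
    omega

/-! ### Exact recursion outside the exceptions -/

theorem P_eq {n : ℕ} (hn : 0 < n) (hE : n ∉ exceptions) : P n = f n + Q (gap n) := by
  have h1 := P_le_f_add hn
  have h2 := P_ge hn
  have h3 := P_Q_gap_le hn hE
  have h4 := Q_gap_le_f_sub hn hE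
  omega

theorem Q_eq {n : ℕ} (hn : 0 < n) (hE : n ∉ exceptions) : Q n = f n + 1 + P (gap n) := by
  have h1 := Q_le_f_add hn
  have h2 := Q_ge hn
  have h3 := P_Q_gap_le hn hE
  omega

theorem zero_mem_exceptions : 0 ∈ exceptions := List.mem_cons_self

end VolPer

theorem mainTheorem8 (n : ℕ) (hg : VolPer.g n < (VolPer.f n : ℤ) - 1)
    (hn : n ∉ VolPer.exceptions) (hnf : n - VolPer.f n ∉ VolPer.exceptions) :
    VolPer.P n = 1 + VolPer.P (n - VolPer.f n) ∧
      VolPer.Q n = 1 + VolPer.Q (n - VolPer.f n) := by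
  have hn0 : 0 < n := Nat.pos_of_ne_zero fun h => hn (h ▸ VolPer.zero_mem_exceptions)
  have hnf0 : 0 < n - VolPer.f n :=
    Nat.pos_of_ne_zero fun h => hnf (h ▸ VolPer.zero_mem_exceptions)
  rw [VolPer.g_eq_gap] at hg
  have hG : VolPer.gap n < VolPer.f n - 1 := by omega
  -- Subtracting `f n` moves to the previous triangular number and keeps the gap; `hG` is what makes
  -- `f (n - f n) = f n - 1`.
  have hadd : n - VolPer.f n + VolPer.gap n = VolPer.tri (VolPer.f n - 1) := by
    have h1 := VolPer.add_gap n
    have h2 := VolPer.tri_succ (VolPer.f n - 1)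
    rw [Nat.sub_add_cancel (by omega)] at h2
    omega
  obtain ⟨h1, h2⟩ := VolPer.f_eq_and_gap_eq hadd hG
  have hP := VolPer.P_eq hnf0 hnf
  have hQ := VolPer.Q_eq hnf0 hnf
  rw [h1, h2] at hP hQ
  rw [VolPer.P_eq hn0 hn, VolPer.Q_eq hn0 hn, hP, hQ]
  omega
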